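/- Let $E,F,G,H$ be real Banach spaces, let $X\subseteq G$ and $Y\subseteq H$ be open, let $1\le p<\infty$ be an integer and $0\le q\le\infty$. For $k\ge 0$ let $\mathcal S^k(G,E)$ be the space of bounded symmetric $k$-linear maps $G^k\to E$ (with $\mathcal S^0(G,E)=E$). Assume that there is a $C^p$ function $\varphi:G\to\mathbb R$ with $\varphi(x)=1$ for $\|x\|\le\frac12$, $\varphi(x)=0$ for $\|x\|\ge1$ and $\sup_{x\in G}\|D^k\varphi(x)\|<\infty$ for $0\le k\le p$. Give $C^p(X,E)$ the topology generated by the seminorms $\rho_{K,k}(f)=\sup_{x\in K}\sup_{0\le j\le k}\|D^jf(x)\|$, where $K\subseteq X$ is compact and $k\le p$ is a nonnegative integer, and give $C^q(Y,F)$ the corresponding topology. Let $T:C^p(X,E)\to C^q(Y,F)$ be a continuous linear operator that is separating (if for every $x\in X$ one has $f(x)=0$ or $g(x)=0$, then for every $y\in Y$ one has $Tf(y)=0$ or $Tg(y)=0$) and nowhere trivial (for every $y\in Y$ there is $f$ with $Tf(y)\ne0$). Let $\mathcal AX$ be the closure of the image of $X$ under $x\mapsto(\psi(x))_{\psi\in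 C^p(X,\mathbb R)}$ in $\mathbb R_\infty^{C^p(X,\mathbb R)}$, where $\mathbb R_\infty$ is the one-point compactification of $\mathbb R$; regard $X$ as a subset of $\mathcal AX$. Let $h:Y\to X$ be the support map of $T$: $h(y)$ is the unique point of $\bigcap_U\overline U$, where $U$ runs over the open subsets of $\mathcal AX$ that contain the closure in $\mathcal AX$ of $\{x\in X:f(x)\ne0\}$ for some $f\in C^p(X,E)$ with $Tf(y)\neq0$. For integers $0\le k\le p$, $y\in Y$ and $S\in\mathcal S^k(G,E)$ put $$\Phi_k(y,S)=\tfrac1{k!}\,(Tf_{y,S})(y),\qquad f_{y,S}(x)=S(x-h(y),\dots,x-h(y));$$ these are the coefficients in the representation $Tf(y)=\sum_{k=0}^p\Phi_k(y,D^kf(h(y)))$. Let $y_0\in Y$ and let $0\le i\le p$ be an integer such that $\Phi_i(y_0,\cdot)\ne0$. Then for every integer $q'$ with $0\le q'\le q$ there are $r>0$ and $C<\infty$ such that $B(y_0,r)\subseteq Y$ and $$\|h(y)-h(y_0)\|^{p-i}\le C\|y-y_0\|^{q'}\qquad\text{for all }y\in B(y_0,r)\text{ with }h(y)\ne h(y_0).$$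 (For $i<p$ the restriction $h(y)\ne h(y_0)$ changes nothing, provided $C\ge 0$, which may be assumed. For $i=p$ it amounts to the convention $0^0=0$ on the left-hand side, so that if $q'\geq 1$ the statement says that $h$ is constant near $y_0$.) -/

import Mathlib

namespace SepOp

open Set Filter Topology TopologicalSpace

universe u v

section Spaces

variable {G : Type u} [NormedAddCommGroup G] [NormedSpace ℝ G]
variable {E : Type v} [NormedAddCommGroup E] [NormedSpace ℝ E]

/-- Extension by zero of a function on the open set `X` to the whole space. On the open set `X` the
derivatives of a function `f : X → E` are those of this extension. -/
noncomputable def zeroExt (X : Opens G) (f : X → E) : G → E :=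
  Function.extend ((↑) : X → G) f 0

theorem zeroExt_apply (X : Opens G) (f : X → E) (x : X) : zeroExt X f x = f x :=
  Subtype.val_injective.extend_apply f 0 x

theorem zeroExt_zero (X : Opens G) : zeroExt X (0 : X → E) = 0 := by
  funext x
  by_cases hx : x ∈ X
  · exact zeroExt_apply X 0 ⟨x, hx⟩
  · exact Function.extend_apply' _ _ _ (by rintro ⟨a, rfl⟩; exact hx a.2)

theorem zeroExt_add (X : Opens G) (f g : X → E) :
    zeroExt X (f + g) = zeroExt X f + zeroExt X g := by
  unfold zeroExt
  rw [← Function.extend_add, add_zero]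

theorem zeroExt_smul (X : Opens G) (c : ℝ) (f : X → E) :
    zeroExt X (c • f) = c • zeroExt X f := by
  unfold zeroExt
  rw [← Function.extend_smul, smul_zero]

/-- `C^p(X, E)`, as a vector space of functions `X → E`; here `0 ≤ p ≤ ∞`. -/
def ckSubmodule (p : ℕ∞) (X : Opens G) (E : Type v) [NormedAddCommGroup E] [NormedSpace ℝ E] :
    Submodule ℝ (X → E) where
  carrier := {f | ContDiffOn ℝ p (zeroExt X f) X}
  zero_mem' := by
    simp only [mem_ofPred_eq, zeroExt_zero]
    exact contDiffOn_const
  add_mem' := by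
    intro f g hf hg
    simp only [mem_ofPred_eq, zeroExt_add] at *
    exact ContDiffOn.add hf hg
  smul_mem' := by
    intro c f hf
    simp only [mem_ofPred_eq, zeroExt_smul] at *
    exact ContDiffOn.const_smul c hf

/-- The space `C^p(X, E)` (a type of its own, as it does not carry the topology of pointwise
convergence). -/
def Ck (p : ℕ∞) (X : Opens G) (E : Type v) [NormedAddCommGroup E] [NormedSpace ℝ E] :
    Type (max u v) :=
  ckSubmodule p X E

variable {p : ℕ∞} {X : Opens G}

noncomputable instance : AddCommGroup (Ck p X E) :=
  inferInstanceAs (AddCommGroup (ckSubmodule p X E))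

noncomputable instance : Module ℝ (Ck p X E) :=
  inferInstanceAs (Module ℝ (ckSubmodule p X E))

instance : FunLike (Ck p X E) X E where
  coe f := f.1
  coe_injective := Subtype.val_injective

/-- The `j`-th Fréchet derivative `D^j f(x)`. -/
noncomputable def Ck.deriv (f : Ck p X E) (j : ℕ) (x : X) :
    ContinuousMultilinearMap ℝ (fun _ : Fin j => G) E :=
  iteratedFDeriv ℝ j (zeroExt X f) x

theorem Ck.contDiffAt (f : Ck p X E) (x : X) : ContDiffAt ℝ p (zeroExt X f) x :=
  ContDiffOn.contDiffAt f.2 (X.isOpen.mem_nhds x.2)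

theorem Ck.continuous_deriv (f : Ck p X E) {j : ℕ} (hj : (j : ℕ∞) ≤ p) :
    Continuous (f.deriv j) :=
  continuous_iff_continuousAt.2 fun x =>
    ((f.contDiffAt x).continuousAt_iteratedFDeriv (mod_cast hj)).comp
      continuous_subtype_val.continuousAt

theorem Ck.deriv_zero (j : ℕ) (x : X) : (0 : Ck p X E).deriv j x = 0 := by
  have h : zeroExt X ((0 : Ck p X E) : X → E) = 0 := zeroExt_zero X
  unfold Ck.deriv
  rw [h]
  simp

theorem Ck.deriv_add (f g : Ck p X E) {j : ℕ} (hj : (j : ℕ∞) ≤ p) (x : X) :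
    (f + g).deriv j x = f.deriv j x + g.deriv j x := by
  have h : zeroExt X ((f + g : Ck p X E) : X → E) = zeroExt X f + zeroExt X g :=
    zeroExt_add X f g
  unfold Ck.deriv
  rw [h]
  exact iteratedFDeriv_add_apply ((f.contDiffAt x).of_le (mod_cast hj))
    ((g.contDiffAt x).of_le (mod_cast hj))

theorem Ck.deriv_smul (c : ℝ) (f : Ck p X E) {j : ℕ} (hj : (j : ℕ∞) ≤ p) (x : X) :
    (c • f).deriv j x = c • f.deriv j x := by
  have h : zeroExt X ((c • f : Ck p X E) : X → E) = c • zeroExt X f := zeroExt_smul X c f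
  unfold Ck.deriv
  rw [h]
  exact iteratedFDeriv_const_smul_apply ((f.contDiffAt x).of_le (mod_cast hj))

theorem Ck.bddAbove_deriv (f : Ck p X E) (K : Compacts X) {k : ℕ} (hk : (k : ℕ∞) ≤ p) :
    BddAbove (range fun z : K × Fin (k + 1) => ‖f.deriv z.2 z.1‖) := by
  have hj : ∀ j : Fin (k + 1), ((j : ℕ) : ℕ∞) ≤ p := fun j =>
    le_trans (mod_cast Nat.lt_succ_iff.1 j.2) hk
  have hc : Continuous fun z : K × Fin (k + 1) => ‖f.deriv z.2 z.1‖ := by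
    refine continuous_prod_of_discrete_right.2 fun j => ?_
    exact ((f.continuous_deriv (hj j)).comp continuous_subtype_val).norm
  have : CompactSpace K := isCompact_iff_compactSpace.1 K.isCompact
  exact (isCompact_range hc).bddAbove

/-- The seminorm `ρ_{K,k}(f) = sup_{x ∈ K} sup_{0 ≤ j ≤ k} ‖D^j f(x)‖`, for `K ⊆ X` compact and
`k ≤ p`. -/
noncomputable def ckSeminorm (p : ℕ∞) (X : Opens G) (E : Type v) [NormedAddCommGroup E]
    [NormedSpace ℝ E] (i : Compacts X × {k : ℕ // (k : ℕ∞) ≤ p}) : Seminorm ℝ (Ck p X E) :=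
  Seminorm.ofSMulLE
    (fun f => ⨆ z : i.1 × Fin (i.2.1 + 1), ‖f.deriv z.2 z.1‖)
    (by simp [Ck.deriv_zero])
    (by
      intro f g
      refine Real.iSup_le (fun z => ?_)
        (add_nonneg (Real.iSup_nonneg fun _ => norm_nonneg _)
          (Real.iSup_nonneg fun _ => norm_nonneg _))
      have hz : ((z.2 : ℕ) : ℕ∞) ≤ p := le_trans (mod_cast Nat.lt_succ_iff.1 z.2.2) i.2.2
      rw [Ck.deriv_add f g hz]
      exact (norm_add_le _ _).trans
        (add_le_add (le_ciSup (f.bddAbove_deriv i.1 i.2.2) z)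
          (le_ciSup (g.bddAbove_deriv i.1 i.2.2) z)))
    (by
      intro c f
      refine Real.iSup_le (fun z => ?_)
        (mul_nonneg (norm_nonneg _) (Real.iSup_nonneg fun _ => norm_nonneg _))
      have hz : ((z.2 : ℕ) : ℕ∞) ≤ p := le_trans (mod_cast Nat.lt_succ_iff.1 z.2.2) i.2.2
      rw [Ck.deriv_smul c f hz, norm_smul]
      exact mul_le_mul_of_nonneg_left (le_ciSup (f.bddAbove_deriv i.1 i.2.2) z) (norm_nonneg _))

instance : Nonempty (Compacts X × {k : ℕ // (k : ℕ∞) ≤ p}) := ⟨(⊥, ⟨0, by simp⟩)⟩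

/-- The linear topology on `C^p(X, E)` generated by the seminorms `ρ_{K,k}`. -/
noncomputable instance : TopologicalSpace (Ck p X E) :=
  SeminormFamily.moduleFilterBasis (𝕜 := ℝ) (ckSeminorm p X E) |>.topology

/-- `S^k(G, E)`: the bounded symmetric `k`-linear maps from `G^k` to `E`. -/
def SymMul (k : ℕ) (G : Type u) (E : Type v) [NormedAddCommGroup G] [NormedSpace ℝ G]
    [NormedAddCommGroup E] [NormedSpace ℝ E] : Type (max u v) :=
  {S : ContinuousMultilinearMap ℝ (fun _ : Fin k => G) E //
    ∀ (σ : Equiv.Perm (Fin k)) (v : Fin k → G), S (v ∘ σ) = S v}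

/-- The function `x ↦ S((x - a)^k)` on `X`, for `S ∈ S^k(G, E)` and `a ∈ G`. -/
noncomputable def monomial (p : ℕ∞) (X : Opens G) {k : ℕ} (S : SymMul k G E) (a : G) :
    Ck p X E :=
  ⟨fun x : X => S.1 (fun _ => (x : G) - a), by
    have h : ContDiff ℝ p fun x : G => S.1 (fun _ : Fin k => x - a) :=
      S.1.contDiff.comp (contDiff_pi.2 fun _ => contDiff_id.sub contDiff_const)
    exact h.contDiffOn.congr fun x hx => zeroExt_apply X _ ⟨x, hx⟩⟩

/-- There is a bump function `φ ∈ C^p(G)` with bounded derivatives up to order `p`, equal to `1` on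
the ball of radius `1/2` and to `0` off the open unit ball. -/
def HasBump (p : ℕ∞) (G : Type u) [NormedAddCommGroup G] [NormedSpace ℝ G] : Prop :=
  ∃ φ : G → ℝ, ContDiff ℝ p φ ∧ (∀ x, ‖x‖ ≤ 1 / 2 → φ x = 1) ∧ (∀ x, 1 ≤ ‖x‖ → φ x = 0) ∧
    ∀ k : ℕ, (k : ℕ∞) ≤ p → ∃ C : ℝ, ∀ x, ‖iteratedFDeriv ℝ k φ x‖ ≤ C

/-- The evaluation map from `X` to `ℝ_∞ ^ C^p(X)`, where `ℝ_∞` is the one-point compactification of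
the real line. -/
noncomputable def evalMap (p : ℕ∞) (X : Opens G) (x : X) : Ck p X ℝ → OnePoint ℝ :=
  fun φ => ((φ x : ℝ) : OnePoint ℝ)

/-- The `C^p(X)`-compactification of `X`: the closure of the image of `X` in `ℝ_∞ ^ C^p(X)`. -/
abbrev Compactification (p : ℕ∞) (X : Opens G) : Type u :=
  ↥(closure (range (evalMap p X)))

/-- The canonical map from `X` to its compactification. -/
noncomputable def toCompactification (p : ℕ∞) (X : Opens G) (x : X) : Compactification p X :=
  ⟨evalMap p X x, subset_closure (mem_range_self x)⟩

/-- The closure, in the compactification, of `{x ∈ X : f x ≠ 0}`. -/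
def closedCarrier (f : Ck p X E) : Set (Compactification p X) :=
  closure (toCompactification p X '' {x | f x ≠ 0})

end Spaces

section Operators

universe w z

variable {G : Type u} [NormedAddCommGroup G] [NormedSpace ℝ G]
variable {E : Type v} [NormedAddCommGroup E] [NormedSpace ℝ E]
variable {H : Type w} [NormedAddCommGroup H] [NormedSpace ℝ H]
variable {F : Type z} [NormedAddCommGroup F] [NormedSpace ℝ F]
variable {p q : ℕ∞} {X : Opens G} {Y : Opens H}

/-- `T` is separating (disjointness preserving). -/
def Separating (T : Ck p X E →ₗ[ℝ] Ck q Y F) : Prop :=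
  ∀ f g : Ck p X E, (∀ x, f x = 0 ∨ g x = 0) → ∀ y, T f y = 0 ∨ T g y = 0

/-- `T` is nowhere trivial: no point of `Y` is a common zero of all the functions `T f`. -/
def NowhereTrivial (T : Ck p X E →ₗ[ℝ] Ck q Y F) : Prop :=
  ∀ y : Y, ∃ f : Ck p X E, T f y ≠ 0

/-- The intersection of the closures of all open subsets `U` of the compactification of `X` that
contain the closed carrier of some `f` with `T f y ≠ 0`. -/
def supportSet (T : Ck p X E →ₗ[ℝ] Ck q Y F) (y : Y) : Set (Compactification p X) :=
  ⋂ U ∈ {U : Set (Compactification p X) |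
    IsOpen U ∧ ∃ f : Ck p X E, T f y ≠ 0 ∧ closedCarrier f ⊆ U}, closure U

open Classical in
/-- The support map `h` of `T`: the set `supportSet T y` has exactly one point, that point lies in
the image of `X`, and `h y` is the corresponding point of `X`. (The value `0` is assigned where this
fails, which does not happen if `T` is continuous, separating and nowhere trivial and `G` has a bump
function.) -/
noncomputable def supportMap (T : Ck p X E →ₗ[ℝ] Ck q Y F) (y : Y) : G :=
  if hx : ∃ x : X, supportSet T y = {toCompactification p X x} then (hx.choose : G) else 0

/-- The coefficient `Φ_k(y, S)` of `D^k f(h y)` in the representation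
`T f (y) = ∑_{k ≤ p} Φ_k(y, D^k f(h y))`: the value of `T f / k!` at `y` for
`f(x) = S((x - h y)^k)`. -/
noncomputable def coeff (T : Ck p X E →ₗ[ℝ] Ck q Y F) (k : ℕ) (y : Y) (S : SymMul k G E) : F :=
  ((k.factorial : ℝ))⁻¹ • T (monomial p X S (supportMap T y)) y

end Operators

end SepOp

/-!
Call `x ∈ X` a support point of `T` at `y` if `T f y` can be nonzero for `f` supported arbitrarily
close to `x`. Continuity of `T` makes `T f y` depend only on the germ of `f` along a compact set,
and bump functions allow one to cut a function off near any point that is not a support point; so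
by compactness every `y` has a support point, which has to be `h y`.

Let `t = ‖h y - h y₀‖ ≤ 1`. The monomial `S((x - h y₀)^i)`, cut off at distance of order `t` from
`h y`, is a function `f` whose derivatives up to order `p` are `O(t^(i - p))`. Near `h y` it is the
monomial, so `T f y` stays away from zero for `y` near `y₀`; near `h y₀` it vanishes, so `T f`
vanishes near `y₀`. Taylor's formula along the segment from `y₀` to `y` bounds `T f y` by
`O(t^(i - p) ‖y - y₀‖^q')`, which is the claim.

The constant comes from the continuity of `T`, hence is uniform only over compact sets, and balls of
`Y` need not be relatively compact. It is enough, however, to treat sequences `y n → y₀`, and the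
segments from `y₀` to the points of such a sequence lie in a compact set star convex at `y₀`.
-/

namespace SepOp

open Set Filter Topology TopologicalSpace Asymptotics

section Analysis

theorem isBigO_of_forall_seq {α E F : Type*} [Norm E] [SeminormedAddCommGroup F] {l : Filter α}
    [l.IsCountablyGenerated] {f : α → E} {g : α → F}
    (h : ∀ u : ℕ → α, Tendsto u atTop l → (f ∘ u) =O[atTop] (g ∘ u)) : f =O[l] g := by
  by_contra hfg
  have hfreq : ∃ᶠ z : ℝ × α in atTop ×ˢ l, z.1 * ‖g z.2‖ < ‖f z.2‖ := by
    intro hev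
    obtain ⟨c, hc⟩ := hev.curry.exists
    exact hfg (IsBigO.of_bound c (hc.mono fun x => not_lt.1))
  obtain ⟨z, hz, hlt⟩ := exists_seq_forall_of_frequently hfreq
  obtain ⟨c, hc⟩ := (h (fun n => (z n).2) (tendsto_snd.comp hz)).bound
  obtain ⟨n, hn, hcn⟩ := (hc.and ((tendsto_fst.comp hz).eventually_ge_atTop c)).exists
  exact (hlt n).not_ge (hn.trans (mul_le_mul_of_nonneg_right hcn (norm_nonneg _)))

section Convexity

variable {V : Type*} [AddCommGroup V] [Module ℝ V]

theorem starConvex_convexJoin_singleton (a : V) (s : Set V) :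
    StarConvex ℝ a (convexJoin ℝ {a} s) := by
  rw [convexJoin_singleton_left]
  exact starConvex_iUnion₂ fun b _ =>
    (convex_segment a b).starConvex (left_mem_segment ℝ a b)

variable [TopologicalSpace V] [IsTopologicalAddGroup V] [ContinuousSMul ℝ V]

theorem isCompact_convexJoin {s t : Set V} (hs : IsCompact s) (ht : IsCompact t) :
    IsCompact (convexJoin ℝ s t) := by
  have himage : convexJoin ℝ s t =
      (fun z : (V × V) × ℝ => z.1.1 + z.2 • (z.1.2 - z.1.1)) '' ((s ×ˢ t) ×ˢ Icc 0 1) := by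
    ext x
    simp only [mem_convexJoin, segment_eq_image', mem_image, Prod.exists, mem_prod]
    grind
  rw [himage]
  exact ((hs.prod ht).prod isCompact_Icc).image (by fun_prop)

theorem exists_compacts_starConvex_of_tendsto [LocallyConvexSpace ℝ V] {Y : Opens V} {u : ℕ → Y}
    {a : Y} (hu : Tendsto u atTop (𝓝 a)) :
    ∃ L : Compacts Y, StarConvex ℝ (a : V) ((↑) '' (L : Set Y)) ∧ ∀ᶠ n in atTop, u n ∈ L := by
  obtain ⟨s, ⟨hsa, hsconv⟩, hsY⟩ :=
    (LocallyConvexSpace.convex_basis (𝕜 := ℝ) (a : V)).mem_iff.1 (Y.isOpen.mem_nhds a.2)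
  have hu' : Tendsto (fun n => (u n : V)) atTop (𝓝 (a : V)) :=
    (continuous_subtype_val.tendsto a).comp hu
  obtain ⟨N, hN⟩ := eventually_atTop.1 (hu'.eventually_mem hsa)
  have has : (a : V) ∈ s := mem_of_mem_nhds hsa
  set t : Set V := insert (a : V) (range fun n => (u (n + N) : V))
  have hts : t ⊆ s := insert_subset has (range_subset_iff.2 fun n => hN _ (by omega))
  have hjoinY : convexJoin ℝ {(a : V)} t ⊆ range ((↑) : Y → V) := by
    rw [Subtype.range_coe]
    exact (convexJoin_subset (singleton_subset_iff.2 has) hts hsconv).trans hsY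
  have hcompact : IsCompact (convexJoin ℝ {(a : V)} t) :=
    isCompact_convexJoin isCompact_singleton
      ((tendsto_add_atTop_iff_nat N).2 hu').isCompact_insert_range
  refine ⟨⟨(↑) ⁻¹' convexJoin ℝ {(a : V)} t, ?_⟩, ?_, ?_⟩
  · rwa [Subtype.isCompact_iff, image_preimage_eq_of_subset hjoinY]
  · rw [Compacts.coe_mk, image_preimage_eq_of_subset hjoinY]
    exact starConvex_convexJoin_singleton _ _
  · filter_upwards [eventually_ge_atTop N] with n hn
    refine subset_convexJoin_right (singleton_nonempty _) (Or.inr ⟨n - N, ?_⟩)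
    simp only [Nat.sub_add_cancel hn]

end Convexity

variable {G : Type*} [NormedAddCommGroup G] [NormedSpace ℝ G]
variable {E : Type*} [NormedAddCommGroup E] [NormedSpace ℝ E]

theorem norm_iteratedFDeriv_le_of_flat {f : G → E} {s : Set G} {a : G} {k : ℕ} {M : ℝ}
    (hs : StarConvex ℝ a s) (hf : ∀ z ∈ s, ContDiffAt ℝ k f z)
    (hflat : ∀ j < k, iteratedFDeriv ℝ j f a = 0)
    (hM : ∀ z ∈ s, ‖iteratedFDeriv ℝ k f z‖ ≤ M) {m n : ℕ} (hmn : m + n = k) :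
    ∀ z ∈ s, ‖iteratedFDeriv ℝ m f z‖ ≤ M * ‖z - a‖ ^ n := by
  induction n generalizing m with
  | zero =>
    obtain rfl : m = k := hmn
    simpa using hM
  | succ n ih =>
    intro z hz
    have hseg : segment ℝ a z ⊆ s := starConvex_iff_segment_subset.1 hs hz
    have hM0 : 0 ≤ M := (norm_nonneg _).trans (hM z hz)
    have hderiv : ∀ w ∈ segment ℝ a z, HasFDerivWithinAt (iteratedFDeriv ℝ m f)
        (fderiv ℝ (iteratedFDeriv ℝ m f) w) (segment ℝ a z) w := fun w hw =>
      ((hf w (hseg hw)).differentiableAt_iteratedFDeriv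
        (mod_cast (by omega : m < k))).hasFDerivAt.hasFDerivWithinAt
    have hbound : ∀ w ∈ segment ℝ a z,
        ‖fderiv ℝ (iteratedFDeriv ℝ m f) w‖ ≤ M * ‖z - a‖ ^ n := fun w hw => by
      rw [norm_fderiv_iteratedFDeriv]
      refine (ih (by omega) w (hseg hw)).trans ?_
      gcongr
      exact norm_sub_le_of_mem_segment hw
    calc ‖iteratedFDeriv ℝ m f z‖
        = ‖iteratedFDeriv ℝ m f z - iteratedFDeriv ℝ m f a‖ := by
          rw [hflat m (by omega), sub_zero]
      _ ≤ M * ‖z - a‖ ^ n * ‖z - a‖ :=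
          (convex_segment a z).norm_image_sub_le_of_norm_hasFDerivWithin_le hderiv hbound
            (left_mem_segment ℝ a z) (right_mem_segment ℝ a z)
      _ = M * ‖z - a‖ ^ (n + 1) := by rw [pow_succ, mul_assoc]

theorem norm_iteratedFDeriv_comp_smul_sub_le {f : G → E} {j : ℕ} (hf : ContDiff ℝ j f) {C : ℝ}
    (hC : ∀ x, ‖iteratedFDeriv ℝ j f x‖ ≤ C) (c : ℝ) (a x : G) :
    ‖iteratedFDeriv ℝ j (fun x => f (c • (x - a))) x‖ ≤ |c| ^ j * C := by
  have hshift : iteratedFDeriv ℝ j (fun x => f (c • (x - a))) x =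
      iteratedFDeriv ℝ j (fun x => f (c • x)) (x - a) :=
    iteratedFDeriv_comp_sub (f := fun x => f (c • x)) j a x
  rw [hshift, iteratedFDeriv_comp_const_smul c hf, norm_smul, norm_pow, Real.norm_eq_abs]
  gcongr
  exact hC _

theorem contDiff_diagonal {i : ℕ} {n : WithTop ℕ∞}
    (S : ContinuousMultilinearMap ℝ (fun _ : Fin i => G) E) :
    ContDiff ℝ n fun x => S fun _ => x :=
  S.contDiff.comp (contDiff_pi.2 fun _ => contDiff_id)

theorem norm_iteratedFDeriv_diagonal_le {i : ℕ}
    (S : ContinuousMultilinearMap ℝ (fun _ : Fin i => G) E) (j : ℕ) (x : G) :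
    ‖iteratedFDeriv ℝ j (fun x => S fun _ => x) x‖ ≤
      i.descFactorial j * ‖S‖ * ‖x‖ ^ (i - j) := by
  let Δ : G →L[ℝ] (Fin i → G) := ContinuousLinearMap.pi fun _ => ContinuousLinearMap.id ℝ G
  have hΔx : ∀ x, ‖Δ x‖ ≤ ‖x‖ := fun x => pi_norm_const_le x
  have hΔ : ‖Δ‖ ≤ 1 := Δ.opNorm_le_bound zero_le_one fun x => by simpa using hΔx x
  calc ‖iteratedFDeriv ℝ j (S ∘ Δ) x‖
      ≤ ‖iteratedFDeriv ℝ j S (Δ x)‖ * ∏ _ : Fin j, ‖Δ‖ := by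
        rw [Δ.iteratedFDeriv_comp_right (n := j) S.contDiff _ le_rfl]
        exact ContinuousMultilinearMap.norm_compContinuousLinearMap_le _ _
    _ ≤ ‖iteratedFDeriv ℝ j S (Δ x)‖ :=
        mul_le_of_le_one_right (norm_nonneg _)
          (Finset.prod_le_one (fun _ _ => norm_nonneg _) fun _ _ => hΔ)
    _ ≤ i.descFactorial j * ‖S‖ * ‖Δ x‖ ^ (i - j) := by
        simpa using S.norm_iteratedFDeriv_le j (Δ x)
    _ ≤ i.descFactorial j * ‖S‖ * ‖x‖ ^ (i - j) := by gcongr; exact hΔx x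

end Analysis

section Functions

variable {G : Type*} [NormedAddCommGroup G] [NormedSpace ℝ G]
variable {E : Type*} [NormedAddCommGroup E] [NormedSpace ℝ E]
variable {p : ℕ∞} {X : Opens G}

theorem HasBump.exists_cutoff (h : HasBump p G) :
    ∃ C : ℕ → ℝ, ∀ (a : G) {r : ℝ}, 0 < r → ∃ ψ : G → ℝ, ContDiff ℝ p ψ ∧
      (∀ x, dist x a ≤ r / 2 → ψ x = 1) ∧ (∀ x, r ≤ dist x a → ψ x = 0) ∧
      ∀ k : ℕ, (k : ℕ∞) ≤ p → ∀ x, ‖iteratedFDeriv ℝ k ψ x‖ ≤ r⁻¹ ^ k * C k := by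
  obtain ⟨φ, hφ, hone, hzero, hbound⟩ := h
  choose! C hC using hbound
  refine ⟨C, fun a r hr => ?_⟩
  have hnorm : ∀ x, ‖r⁻¹ • (x - a)‖ = dist x a / r := fun x => by
    rw [norm_smul, norm_inv, Real.norm_of_nonneg hr.le, dist_eq_norm, div_eq_inv_mul]
  refine ⟨fun x => φ (r⁻¹ • (x - a)),
    hφ.comp ((contDiff_id.sub contDiff_const).const_smul _), fun x hx => hone _ ?_,
    fun x hx => hzero _ ?_, fun k hk x => ?_⟩
  · rw [hnorm, div_le_iff₀ hr]
    linarith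
  · rwa [hnorm, le_div_iff₀ hr, one_mul]
  · simpa only [abs_of_pos (inv_pos.2 hr)] using
      norm_iteratedFDeriv_comp_smul_sub_le (hφ.of_le (mod_cast hk)) (hC k hk) r⁻¹ a x

theorem HasBump.exists_cutoff_smul_diagonal (h : HasBump p G) {i : ℕ}
    (S : ContinuousMultilinearMap ℝ (fun _ : Fin i => G) E) :
    ∃ M : ℕ → ℝ, ∀ v : G, ‖v‖ = 1 → ∃ χ : G → ℝ, ContDiff ℝ p χ ∧
      (∀ᶠ x in 𝓝 v, χ x = 1) ∧ (∀ᶠ x in 𝓝 0, χ x = 0) ∧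
      ∀ j : ℕ, (j : ℕ∞) ≤ p → ∀ x, ‖iteratedFDeriv ℝ j (fun x => χ x • S fun _ => x) x‖ ≤ M j := by
  obtain ⟨C, hC⟩ := h.exists_cutoff
  let D : ℕ → ℝ := fun j => i.descFactorial j * ‖S‖ * 2 ^ (i - j)
  refine ⟨fun j => ∑ k ∈ Finset.range (j + 1), (j.choose k : ℝ) * (2⁻¹⁻¹ ^ k * C k) * D (j - k),
    fun v hv => ?_⟩
  obtain ⟨χ, hχ, hone, hzero, hbound⟩ := hC v (r := 2⁻¹) (by norm_num)
  have hnhds_one : ∀ᶠ x in 𝓝 v, χ x = 1 :=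
    eventually_of_mem (Metric.closedBall_mem_nhds v (by norm_num)) hone
  have hvanish : ∀ x, 2⁻¹ < dist x v → ∀ᶠ z in 𝓝 x, χ z = 0 := fun x hx => by
    have hdist : ContinuousAt (dist · v) x := by fun_prop
    exact (hdist.eventually (lt_mem_nhds hx)).mono fun z hz => hzero z hz.le
  refine ⟨χ, hχ, hnhds_one, hvanish 0 (by rw [dist_zero_left, hv]; norm_num), fun j hj x => ?_⟩
  have hterm : ∀ k ∈ Finset.range (j + 1),
    ‖iteratedFDeriv ℝ k χ x‖ ≤ 2⁻¹⁻¹ ^ k * C k := fun k hk =>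
      hbound k ((mod_cast Nat.lt_succ_iff.1 (Finset.mem_range.1 hk) : (k : ℕ∞) ≤ j).trans hj) x
  rcases le_or_gt ‖x‖ 2 with hx | hx
  · refine (norm_iteratedFDeriv_smul_le hχ (contDiff_diagonal S) x (mod_cast hj)).trans
      (Finset.sum_le_sum fun k hk => ?_)
    have hS : ‖iteratedFDeriv ℝ (j - k) (fun x => S fun _ => x) x‖ ≤ D (j - k) :=
      (norm_iteratedFDeriv_diagonal_le S (j - k) x).trans (by simp only [D]; gcongr)
    have hC0 : 0 ≤ 2⁻¹⁻¹ ^ k * C k := (norm_nonneg _).trans (hterm k hk)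
    gcongr
    exact hterm k hk
  · have hfar : 2⁻¹ < dist x v := by
      have := norm_sub_norm_le x v
      rw [dist_eq_norm]
      linarith
    have hlocal : (fun x => χ x • S fun _ => x) =ᶠ[𝓝 x] fun _ => 0 :=
      (hvanish x hfar).mono fun z hz => by simp only [hz, zero_smul]
    rw [(hlocal.iteratedFDeriv ℝ j).eq_of_nhds, iteratedFDeriv_fun_zero, Pi.zero_apply, norm_zero]
    exact Finset.sum_nonneg fun k hk =>
      mul_nonneg (mul_nonneg (Nat.cast_nonneg _) ((norm_nonneg _).trans (hterm k hk)))
        (by positivity)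

theorem HasBump.exists_cutoff_smul_monomial (h : HasBump p G) {i : ℕ}
    (S : ContinuousMultilinearMap ℝ (fun _ : Fin i => G) E) :
    ∃ M : ℕ → ℝ, ∀ a b : G, a ≠ b → ∃ ψ : G → ℝ, ContDiff ℝ p ψ ∧
      (∀ᶠ x in 𝓝 a, ψ x = 1) ∧ (∀ᶠ x in 𝓝 b, ψ x = 0) ∧ ∀ j : ℕ, (j : ℕ∞) ≤ p → ∀ x,
        ‖iteratedFDeriv ℝ j (fun x => ψ x • S fun _ => x - b) x‖ ≤
          ‖a - b‖ ^ i * (‖a - b‖⁻¹ ^ j * M j) := by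
  obtain ⟨M, hM⟩ := h.exists_cutoff_smul_diagonal S
  refine ⟨M, fun a b hab => ?_⟩
  set t := ‖a - b‖
  have ht : 0 < t := norm_pos_iff.2 (sub_ne_zero.2 hab)
  obtain ⟨χ, hχ, hone, hzero, hbound⟩ := hM (t⁻¹ • (a - b))
    (by rw [norm_smul, norm_inv, Real.norm_of_nonneg ht.le, inv_mul_cancel₀ ht.ne'])
  have hscale : Continuous fun x : G => t⁻¹ • (x - b) := by fun_prop
  refine ⟨fun x => χ (t⁻¹ • (x - b)),
    hχ.comp ((contDiff_id.sub contDiff_const).const_smul _), hscale.continuousAt.eventually hone,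
    (hscale.tendsto' b 0 (by simp)).eventually hzero, fun j hj x => ?_⟩
  set g : G → E := fun x => χ x • S fun _ => x
  have hg : ContDiff ℝ j g := (hχ.of_le (mod_cast hj)).smul (contDiff_diagonal S)
  have hgscale : ContDiff ℝ j fun x => g (t⁻¹ • (x - b)) :=
    hg.comp ((contDiff_id.sub contDiff_const).const_smul _)
  -- Homogeneity of degree `i` reduces the estimate to the one for a unit vector.
  have hhom : (fun x => χ (t⁻¹ • (x - b)) • S fun _ => x - b) =
      t ^ i • fun x => g (t⁻¹ • (x - b)) := by
    funext x
    have hSx : (S fun _ => x - b) = t ^ i • S fun _ => t⁻¹ • (x - b) := by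
      rw [S.map_smul_univ (fun _ => t⁻¹) fun _ => x - b, Finset.prod_const, Finset.card_fin,
        smul_smul, ← mul_pow, mul_inv_cancel₀ ht.ne', one_pow, one_smul]
    rw [hSx, smul_comm]
    rfl
  rw [hhom, iteratedFDeriv_const_smul_apply hgscale.contDiffAt, norm_smul, norm_pow,
    Real.norm_of_nonneg ht.le]
  gcongr
  simpa only [abs_of_pos (inv_pos.2 ht)] using
    norm_iteratedFDeriv_comp_smul_sub_le hg (hbound j hj) t⁻¹ b x

theorem withSeminorms_ckSeminorm : WithSeminorms (ckSeminorm p X E) := ⟨rfl⟩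

theorem ckSeminorm_le {κ : Compacts X × {k : ℕ // (k : ℕ∞) ≤ p}} {f : Ck p X E} {M : ℝ}
    (hM : 0 ≤ M) (h : ∀ x ∈ κ.1, ∀ j ≤ κ.2.1, ‖f.deriv j x‖ ≤ M) :
    ckSeminorm p X E κ f ≤ M :=
  Real.iSup_le (fun z => h _ z.1.2 _ (Nat.lt_succ_iff.1 z.2.2)) hM

theorem norm_deriv_le_ckSeminorm (κ : Compacts X × {k : ℕ // (k : ℕ∞) ≤ p}) (f : Ck p X E) {x : X}
    (hx : x ∈ κ.1) {j : ℕ} (hj : j ≤ κ.2.1) : ‖f.deriv j x‖ ≤ ckSeminorm p X E κ f :=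
  le_ciSup (f := fun z : κ.1 × Fin (κ.2.1 + 1) => ‖f.deriv z.2 z.1‖)
    (f.bddAbove_deriv κ.1 κ.2.2) (⟨x, hx⟩, ⟨j, Nat.lt_succ_iff.2 hj⟩)

theorem ckSeminorm_mono : Monotone (ckSeminorm p X E) := fun _ κ hle f =>
  ckSeminorm_le (apply_nonneg _ f) fun _ hx _ hj =>
    norm_deriv_le_ckSeminorm κ f (hle.1 hx) (hj.trans hle.2)

theorem Ck.continuous (f : Ck p X E) : Continuous f :=
  continuous_iff_continuousAt.2 fun x =>
    ((f.contDiffAt x).continuousAt.comp continuous_subtype_val.continuousAt).congr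
      (Eventually.of_forall (zeroExt_apply X f))

theorem Ck.norm_deriv_zero (f : Ck p X E) (x : X) : ‖f.deriv 0 x‖ = ‖f x‖ := by
  rw [Ck.deriv, norm_iteratedFDeriv_zero, zeroExt_apply]

theorem Ck.deriv_congr {f : Ck p X E} {x : X} {g : G → E} (h : ∀ᶠ z : X in 𝓝 x, f z = g z)
    (j : ℕ) : f.deriv j x = iteratedFDeriv ℝ j g x := by
  have hext : zeroExt X f =ᶠ[𝓝 (x : G)] g := by
    rw [← X.isOpen.isOpenEmbedding_subtypeVal.map_nhds_eq x]
    exact eventually_map.2 (h.mono fun z hz => (zeroExt_apply X f z).trans hz)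
  exact (hext.iteratedFDeriv ℝ j).eq_of_nhds

theorem Ck.deriv_eq_zero {f : Ck p X E} {x : X} (h : ∀ᶠ z in 𝓝 x, f z = 0) (j : ℕ) :
    f.deriv j x = 0 :=
  (Ck.deriv_congr (g := fun _ => 0) h j).trans (by simp)

theorem Ck.norm_apply_le_ckSeminorm_mul_pow {f : Ck p X E} {a : X}
    (hf : ∀ᶠ z in 𝓝 a, f z = 0) (κ : Compacts X × {k : ℕ // (k : ℕ∞) ≤ p})
    (hκ : StarConvex ℝ (a : G) ((↑) '' (κ.1 : Set X))) {x : X} (hx : x ∈ κ.1) :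
    ‖f x‖ ≤ ckSeminorm p X E κ f * ‖(x : G) - a‖ ^ (κ.2 : ℕ) := by
  rw [← zeroExt_apply X f x, ← norm_iteratedFDeriv_zero (𝕜 := ℝ)]
  refine norm_iteratedFDeriv_le_of_flat hκ ?_ (fun j _ => Ck.deriv_eq_zero hf j) ?_ (zero_add _) _
    (mem_image_of_mem _ hx)
  · rintro _ ⟨z, -, rfl⟩
    exact (f.contDiffAt z).of_le (mod_cast κ.2.2)
  · rintro _ ⟨z, hz, rfl⟩
    exact norm_deriv_le_ckSeminorm κ f hz le_rfl

/-- The product of `f ∈ C^p(X, E)` with a scalar `C^p` function on the whole space. -/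
noncomputable def Ck.mul (ψ : G → ℝ) (hψ : ContDiff ℝ p ψ) (f : Ck p X E) : Ck p X E :=
  ⟨fun x : X => ψ x • f x, (hψ.contDiffOn.smul f.2).congr fun x hx => by
    rw [zeroExt_apply X _ ⟨x, hx⟩]
    exact congrArg (ψ x • ·) (zeroExt_apply X f ⟨x, hx⟩).symm⟩

theorem Ck.mul_apply (ψ : G → ℝ) (hψ : ContDiff ℝ p ψ) (f : Ck p X E) (x : X) :
    Ck.mul ψ hψ f x = ψ x • f x := rfl

theorem Ck.sub_apply (f g : Ck p X E) (x : X) : (f - g) x = f x - g x := rfl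

theorem HasBump.exists_localized_monomial {p : ℕ} (h : HasBump (p : ℕ∞) G) (X : Opens G) {i : ℕ}
    (hi : i ≤ p) (S : SymMul i G E) :
    ∃ M : ℝ, ∀ a b : X, a ≠ b → ‖(a : G) - b‖ ≤ 1 → ∃ f : Ck (p : ℕ∞) X E,
      (∀ᶠ z in 𝓝 a, f z = monomial (p : ℕ∞) X S (b : G) z) ∧ (∀ᶠ z in 𝓝 b, f z = 0) ∧
      ∀ κ, ckSeminorm p X E κ f * ‖(a : G) - b‖ ^ (p - i) ≤ M := by
  obtain ⟨M, hM⟩ := h.exists_cutoff_smul_monomial S.1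
  obtain ⟨B, hB⟩ := ((Finset.range (p + 1)).image M).exists_le
  refine ⟨B, fun a b hab hle => ?_⟩
  obtain ⟨ψ, hψ, hone, hzero, hbound⟩ := hM a b (Subtype.coe_injective.ne hab)
  set t := ‖(a : G) - b‖
  have ht : 0 < t := norm_pos_iff.2 (sub_ne_zero.2 (Subtype.coe_injective.ne hab))
  set m := monomial (p : ℕ∞) X S (b : G)
  have hderiv : ∀ x, ∀ j ≤ p, ‖(Ck.mul ψ hψ m).deriv j x‖ ≤ B / t ^ (p - i) := by
    intro x j hj
    rw [Ck.deriv_congr (g := fun x => ψ x • S.1 fun _ => x - b) (Eventually.of_forall fun _ => rfl)]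
    have hMj : M j ≤ B :=
      hB _ (Finset.mem_image_of_mem M (Finset.mem_range.2 (Nat.lt_succ_iff.2 hj)))
    have hM0 : 0 ≤ M j := by
      have := (norm_nonneg _).trans (hbound j (mod_cast hj) x)
      rwa [← mul_assoc, mul_nonneg_iff_of_pos_left (by positivity)] at this
    calc ‖iteratedFDeriv ℝ j (fun x => ψ x • S.1 fun _ => x - b) x‖
        ≤ t ^ i * (t⁻¹ ^ j * M j) := hbound j (mod_cast hj) x
      _ ≤ t ^ i * (t⁻¹ ^ p * B) := by
          gcongr
          exact (one_le_inv₀ ht).2 hle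
      _ = B / t ^ (p - i) := by
          rw [pow_sub₀ t ht.ne' hi, inv_pow]
          field_simp
  refine ⟨Ck.mul ψ hψ m, ?_, ?_, fun κ => ?_⟩
  · filter_upwards [continuous_subtype_val.continuousAt.eventually hone] with z hz
    rw [Ck.mul_apply, hz, one_smul]
  · filter_upwards [continuous_subtype_val.continuousAt.eventually hzero] with z hz
    rw [Ck.mul_apply, hz, zero_smul]
  · rw [← le_div_iff₀ (by positivity)]
    exact ckSeminorm_le ((norm_nonneg _).trans (hderiv a 0 (Nat.zero_le p))) fun x _ j hj =>
      hderiv x j (hj.trans (mod_cast κ.2.2))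

end Functions

section Operators

variable {G : Type*} [NormedAddCommGroup G] [NormedSpace ℝ G]
variable {E : Type*} [NormedAddCommGroup E] [NormedSpace ℝ E]
variable {H : Type*} [NormedAddCommGroup H] [NormedSpace ℝ H]
variable {F : Type*} [NormedAddCommGroup F] [NormedSpace ℝ F]
variable {p q : ℕ∞} {X : Opens G} {Y : Opens H}
variable {T : Ck p X E →ₗ[ℝ] Ck q Y F} {y : Y} {x : X}

theorem exists_ckSeminorm_apply_le (hT : Continuous T)
    (κ : Compacts Y × {k : ℕ // (k : ℕ∞) ≤ q}) :
    ∃ (κ' : Compacts X × {k : ℕ // (k : ℕ∞) ≤ p}) (C : ℝ), 0 ≤ C ∧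
      ∀ f, ckSeminorm q Y F κ (T f) ≤ C * ckSeminorm p X E κ' f := by
  have hcomp : Continuous ((ckSeminorm q Y F κ).comp T) :=
    (withSeminorms_ckSeminorm.continuous_seminorm κ).comp hT
  obtain ⟨s, C, -, hC⟩ := Seminorm.bound_of_continuous withSeminorms_ckSeminorm _ hcomp
  obtain ⟨κ', hle⟩ := s.exists_le
  refine ⟨κ', C, C.2, fun f => (hC f).trans ?_⟩
  exact mul_le_mul_of_nonneg_left
    (Seminorm.finset_sup_apply_le (apply_nonneg _ f) fun ι hι => ckSeminorm_mono (hle ι hι) f) C.2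

/-- The point `x` supports `T` at `y`: `T f y` can be nonzero for functions `f` supported
arbitrarily close to `x`. This describes the support map of `T` inside `X`, without the
compactification. -/
def IsSupportPoint (T : Ck p X E →ₗ[ℝ] Ck q Y F) (y : Y) (x : X) : Prop :=
  ∀ V ∈ 𝓝 x, ∃ f : Ck p X E, (∀ z ∉ V, f z = 0) ∧ T f y ≠ 0

/-- The set `s` does not matter for `T` at `y`: every function can be made to vanish near `s`
without enlarging its carrier and without changing the value of its image at `y`. Carriers must not
grow in order that two such modifications can be performed one after the other. -/
def IsNegligible (T : Ck p X E →ₗ[ℝ] Ck q Y F) (y : Y) (s : Set X) : Prop :=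
  ∀ f : Ck p X E, ∃ g : Ck p X E,
    (∀ x ∈ s, ∀ᶠ z in 𝓝 x, g z = 0) ∧ (∀ x, f x = 0 → g x = 0) ∧ T g y = T f y

namespace IsNegligible

theorem empty : IsNegligible T y ∅ := fun f => ⟨f, fun _ => False.elim, fun _ => id, rfl⟩

theorem mono {s t : Set X} (hst : s ⊆ t) (ht : IsNegligible T y t) : IsNegligible T y s :=
  fun f => (ht f).imp fun _ hg => ⟨fun x hx => hg.1 x (hst hx), hg.2⟩

theorem union {s t : Set X} (hs : IsNegligible T y s) (ht : IsNegligible T y t) :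
    IsNegligible T y (s ∪ t) := by
  intro f
  obtain ⟨g, hgs, hfg, hgy⟩ := hs f
  obtain ⟨k, hkt, hgk, hky⟩ := ht g
  refine ⟨k, ?_, fun x hx => hgk x (hfg x hx), hky.trans hgy⟩
  rintro x (hx | hx)
  · exact (hgs x hx).mono hgk
  · exact hkt x hx

end IsNegligible

theorem HasBump.exists_mem_nhds_isNegligible (hbump : HasBump p G) (hx : ¬IsSupportPoint T y x) :
    ∃ U ∈ 𝓝 x, IsNegligible T y U := by
  obtain ⟨V, hV, hvanish⟩ : ∃ V ∈ 𝓝 x, ∀ f : Ck p X E, (∀ z ∉ V, f z = 0) → T f y = 0 := by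
    simpa [IsSupportPoint] using hx
  obtain ⟨r, hr, hrV⟩ := Metric.mem_nhds_iff.1 hV
  obtain ⟨C, hC⟩ := hbump.exists_cutoff
  obtain ⟨ψ, hψ, hone, hzero, -⟩ := hC (x : G) hr
  refine ⟨Metric.ball x (r / 2), Metric.ball_mem_nhds x (half_pos hr), fun f =>
    ⟨f - Ck.mul ψ hψ f, fun w hw => ?_, fun w hw => ?_, ?_⟩⟩
  · filter_upwards [Metric.isOpen_ball.mem_nhds hw] with z hz
    rw [Ck.sub_apply, Ck.mul_apply, hone z (Metric.mem_ball.1 hz).le, one_smul, sub_self]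
  · rw [Ck.sub_apply, Ck.mul_apply, hw, smul_zero, sub_self]
  · have hψf : T (Ck.mul ψ hψ f) y = 0 := hvanish _ fun z hz => by
      rw [Ck.mul_apply, hzero z (not_lt.1 fun hlt => hz (hrV hlt)), zero_smul]
    rw [map_sub, Ck.sub_apply, hψf, sub_zero]

theorem exists_isSupportPoint (hbump : HasBump p G) (hT : Continuous T) (hnt : NowhereTrivial T)
    (y : Y) : ∃ x, IsSupportPoint T y x := by
  by_contra! hnone
  obtain ⟨κ, C, -, hκ⟩ := exists_ckSeminorm_apply_le hT (⟨{y}, isCompact_singleton⟩, ⟨0, by simp⟩)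
  have hnegligible : IsNegligible T y κ.1 :=
    κ.1.isCompact.induction_on .empty (fun _ _ => .mono) (fun _ _ => .union) fun x _ =>
      (hbump.exists_mem_nhds_isNegligible (hnone x)).imp fun _ hU =>
        ⟨mem_nhdsWithin_of_mem_nhds hU.1, hU.2⟩
  obtain ⟨f, hf⟩ := hnt y
  obtain ⟨g, hg, -, hgy⟩ := hnegligible f
  have hgκ : ckSeminorm p X E κ g ≤ 0 :=
    ckSeminorm_le le_rfl fun x hx j _ => by rw [Ck.deriv_eq_zero (hg x hx), norm_zero]
  have hzero : ckSeminorm p X E κ g = 0 := hgκ.antisymm (apply_nonneg _ g)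
  refine hf (hgy ▸ norm_le_zero_iff.1 ?_)
  calc ‖T g y‖ = ‖(T g).deriv 0 y‖ := ((T g).norm_deriv_zero y).symm
    _ ≤ C * ckSeminorm p X E κ g :=
        (norm_deriv_le_ckSeminorm _ (T g) (mem_singleton y) le_rfl).trans (hκ g)
    _ = 0 := by rw [hzero, mul_zero]

namespace IsSupportPoint

theorem apply_eq_zero (h : IsSupportPoint T y x) (hsep : Separating T) {g : Ck p X E}
    (hg : ∀ᶠ z in 𝓝 x, g z = 0) : T g y = 0 := by
  obtain ⟨f, hf, hfy⟩ := h _ hg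
  exact (hsep f g (fun z => or_iff_not_imp_right.2 (hf z)) y).resolve_left hfy

theorem apply_congr (h : IsSupportPoint T y x) (hsep : Separating T) {f g : Ck p X E}
    (hfg : ∀ᶠ z in 𝓝 x, f z = g z) : T f y = T g y := by
  rw [← sub_eq_zero, ← Ck.sub_apply, ← map_sub]
  exact h.apply_eq_zero hsep (hfg.mono fun z hz => by rw [Ck.sub_apply, hz, sub_self])

theorem mem_closure_of_apply_ne_zero (h : IsSupportPoint T y x) (hsep : Separating T)
    {f : Ck p X E} (hf : T f y ≠ 0) : x ∈ closure {z | f z ≠ 0} := by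
  rw [mem_closure_iff_frequently]
  exact fun hev => hf (h.apply_eq_zero hsep (hev.mono fun z => not_not.1))

theorem eventually_apply_eq_zero (h : IsSupportPoint T y x) (hsep : Separating T) {f : Ck p X E}
    (hf : ∀ᶠ z in 𝓝 x, f z = 0) : ∀ᶠ w in 𝓝 y, T f w = 0 := by
  obtain ⟨g, hg, hgy⟩ := h _ hf
  filter_upwards [(T g).continuous.continuousAt.eventually_ne hgy] with w hw
  exact (hsep g f (fun z => or_iff_not_imp_right.2 (hg z)) w).resolve_left hw

end IsSupportPoint

theorem continuous_of_forall_isSupportPoint (hsep : Separating T) {h : Y → X}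
    (hh : ∀ y, IsSupportPoint T y (h y)) : Continuous h := by
  refine continuous_iff_continuousAt.2 fun y V hV => ?_
  obtain ⟨W, hW, hclosed, hWV⟩ := exists_mem_nhds_isClosed_subset hV
  obtain ⟨g, hg, hgy⟩ := hh y W hW
  rw [mem_map]
  filter_upwards [(T g).continuous.continuousAt.eventually_ne hgy] with w hw
  have hcarrier : {z | g z ≠ 0} ⊆ W := fun z hz => not_not.1 (mt (hg z) hz)
  exact hWV (closure_minimal hcarrier hclosed ((hh w).mem_closure_of_apply_ne_zero hsep hw))

theorem continuous_toCompactification (p : ℕ∞) (X : Opens G) :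
    Continuous (toCompactification p X) :=
  (continuous_pi fun ψ => OnePoint.continuous_coe.comp ψ.continuous).subtype_mk _

theorem toCompactification_injective (p : ℕ∞) (X : Opens G) :
    Function.Injective (toCompactification p X) := by
  intro a b hab
  by_contra hne
  obtain ⟨l, hl⟩ := SeparatingDual.exists_separating_of_ne (R := ℝ) (Subtype.coe_injective.ne hne)
  let S : SymMul 1 G ℝ := ⟨ContinuousMultilinearMap.ofSubsingleton ℝ G ℝ 0 l, fun σ v => by
    rw [Subsingleton.elim σ 1]; rfl⟩
  have heval : l (a - 0) = l (b - 0) :=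
    OnePoint.coe_injective (congrFun (congrArg Subtype.val hab) (monomial p X S 0))
  exact hl (by simpa using heval)

namespace IsSupportPoint

theorem exists_closedCarrier_subset (h : IsSupportPoint T y x) {V : Set (Compactification p X)}
    (hV : V ∈ 𝓝 (toCompactification p X x)) : ∃ f, T f y ≠ 0 ∧ closedCarrier f ⊆ V := by
  obtain ⟨W, hW, hclosed, hWV⟩ := exists_mem_nhds_isClosed_subset hV
  obtain ⟨f, hf, hfy⟩ := h _ ((continuous_toCompactification p X).continuousAt hW)
  refine ⟨f, hfy, (closure_minimal ?_ hclosed).trans hWV⟩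
  rintro _ ⟨z, hz, rfl⟩
  exact not_not.1 (mt (hf z) hz)

theorem supportSet_eq (h : IsSupportPoint T y x) (hsep : Separating T) :
    supportSet T y = {toCompactification p X x} := by
  refine Subset.antisymm (fun z hz => ?_) (singleton_subset_iff.2 (mem_iInter₂.2 ?_))
  · by_contra hne
    obtain ⟨W, U, hW, hU, hzW, hxU, hWU⟩ := t2_separation hne
    obtain ⟨f, hfy, hfU⟩ := h.exists_closedCarrier_subset (hU.mem_nhds hxU)
    exact disjoint_left.1 (hWU.closure_right hW) hzW (mem_iInter₂.1 hz U ⟨hU, f, hfy, hfU⟩)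
  · rintro U ⟨-, f, hf, hfU⟩
    exact subset_closure (hfU (image_closure_subset_closure_image
      (continuous_toCompactification p X)
      (mem_image_of_mem _ (h.mem_closure_of_apply_ne_zero hsep hf))))

theorem supportMap_eq (h : IsSupportPoint T y x) (hsep : Separating T) : supportMap T y = x := by
  have hex : ∃ x : X, supportSet T y = {toCompactification p X x} := ⟨x, h.supportSet_eq hsep⟩
  rw [supportMap, dif_pos hex]
  exact congrArg Subtype.val (toCompactification_injective p X
    (singleton_injective (hex.choose_spec.symm.trans (h.supportSet_eq hsep))))

end IsSupportPoint

section Estimate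

variable {p : ℕ} {T : Ck (p : ℕ∞) X E →ₗ[ℝ] Ck q Y F}

theorem exists_norm_apply_monomial_mul_pow_le (hbump : HasBump (p : ℕ∞) G) (hT : Continuous T)
    (hsep : Separating T) {y₀ : Y} {x₀ : X} (h₀ : IsSupportPoint T y₀ x₀) {i : ℕ} (hi : i ≤ p)
    (S : SymMul i G E) (κ : Compacts Y × {k : ℕ // (k : ℕ∞) ≤ q})
    (hκ : StarConvex ℝ (y₀ : H) ((↑) '' (κ.1 : Set Y))) :
    ∃ C : ℝ, ∀ y ∈ κ.1, ∀ x, IsSupportPoint T y x → x ≠ x₀ → ‖(x : G) - x₀‖ ≤ 1 →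
      ‖T (monomial p X S (x₀ : G)) y‖ * ‖(x : G) - x₀‖ ^ (p - i) ≤
        C * ‖(y : H) - y₀‖ ^ (κ.2 : ℕ) := by
  obtain ⟨κ', C, hC, hbound⟩ := exists_ckSeminorm_apply_le hT κ
  obtain ⟨M, hM⟩ := hbump.exists_localized_monomial X hi S
  refine ⟨C * M, fun y hy x hx hne hle => ?_⟩
  obtain ⟨f, hfx, hfx₀, hfM⟩ := hM x x₀ hne hle
  set t := ‖(x : G) - x₀‖
  set d := ‖(y : H) - y₀‖
  have hflat : ∀ᶠ w in 𝓝 y₀, T f w = 0 := h₀.eventually_apply_eq_zero hsep hfx₀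
  calc ‖T (monomial p X S (x₀ : G)) y‖ * t ^ (p - i)
      = ‖T f y‖ * t ^ (p - i) := by rw [hx.apply_congr hsep hfx]
    _ ≤ ckSeminorm q Y F κ (T f) * d ^ (κ.2 : ℕ) * t ^ (p - i) := by
        gcongr
        exact Ck.norm_apply_le_ckSeminorm_mul_pow hflat κ hκ hy
    _ ≤ C * ckSeminorm p X E κ' f * d ^ (κ.2 : ℕ) * t ^ (p - i) := by
        gcongr
        exact hbound f
    _ = C * (ckSeminorm p X E κ' f * t ^ (p - i)) * d ^ (κ.2 : ℕ) := by ring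
    _ ≤ C * M * d ^ (κ.2 : ℕ) := by
        gcongr
        exact hfM κ'

theorem isBigO_norm_sub_pow_of_forall_isSupportPoint (hbump : HasBump (p : ℕ∞) G)
    (hT : Continuous T) (hsep : Separating T) {h : Y → X} (hh : ∀ y, IsSupportPoint T y (h y))
    {y₀ : Y} {i : ℕ} (hi : i ≤ p) {S : SymMul i G E}
    (hS : T (monomial p X S (h y₀ : G)) y₀ ≠ 0) {k : ℕ} (hk : (k : ℕ∞) ≤ q) :
    (fun y => ‖(h y : G) - h y₀‖ ^ (p - i)) =O[𝓝[{y | h y ≠ h y₀}] y₀]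
      fun y => ‖(y : H) - y₀‖ ^ k := by
  refine isBigO_of_forall_seq fun u hu => ?_
  obtain ⟨hlim, hne⟩ := tendsto_nhdsWithin_iff.1 hu
  obtain ⟨L, hL, hmem⟩ := exists_compacts_starConvex_of_tendsto hlim
  obtain ⟨C, hC⟩ := exists_norm_apply_monomial_mul_pow_le hbump hT hsep (hh y₀) hi S (L, ⟨k, hk⟩) hL
  set m := monomial p X S (h y₀ : G)
  have hclose : ∀ᶠ n in atTop, dist (h (u n)) (h y₀) ≤ 1 :=
    (((continuous_of_forall_isSupportPoint hsep hh).tendsto y₀).comp hlim).eventually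
      (Metric.closedBall_mem_nhds _ one_pos)
  have hlower : ∀ᶠ n in atTop, ‖T m y₀‖ / 2 ≤ ‖T m (u n)‖ :=
    (((T m).continuous.norm.tendsto y₀).comp hlim).eventually
      (le_mem_nhds (half_lt_self (norm_pos_iff.2 hS)))
  refine IsBigO.of_bound (C / (‖T m y₀‖ / 2)) ?_
  filter_upwards [hne, hmem, hclose, hlower] with n hne hmem hclose hlower
  have hest := hC (u n) hmem (h (u n)) (hh _) hne (by rwa [← dist_eq_norm])
  simp only [Function.comp_apply, norm_pow, norm_norm]
  rw [div_mul_eq_mul_div, le_div_iff₀ (half_pos (norm_pos_iff.2 hS)), mul_comm]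
  exact (mul_le_mul_of_nonneg_right hlower (by positivity)).trans hest

end Estimate

end Operators

end SepOp

theorem theorem12_general
    {G E H F : Type*}
    [NormedAddCommGroup G] [NormedSpace ℝ G]
    [NormedAddCommGroup E] [NormedSpace ℝ E]
    [NormedAddCommGroup H] [NormedSpace ℝ H]
    [NormedAddCommGroup F] [NormedSpace ℝ F]
    (p : ℕ) (q : ℕ∞) (hbump : SepOp.HasBump (p : ℕ∞) G)
    (X : TopologicalSpace.Opens G) (Y : TopologicalSpace.Opens H)
    (T : SepOp.Ck (p : ℕ∞) X E →ₗ[ℝ] SepOp.Ck q Y F)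
    (hsep : SepOp.Separating T) (hnt : SepOp.NowhereTrivial T) (hcont : Continuous T)
    (y₀ : Y) (i : ℕ) (hi : i ≤ p) (hΦ : ∃ S : SepOp.SymMul i G E, SepOp.coeff T i y₀ S ≠ 0)
    (q' : ℕ) (hq' : (q' : ℕ∞) ≤ q) :
    ∃ r : ℝ, 0 < r ∧ Metric.ball (y₀ : H) r ⊆ Y ∧ ∃ C : ℝ,
      ∀ y : Y, (y : H) ∈ Metric.ball (y₀ : H) r →
        SepOp.supportMap T y ≠ SepOp.supportMap T y₀ →
        ‖SepOp.supportMap T y - SepOp.supportMap T y₀‖ ^ (p - i) ≤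
          C * ‖(y : H) - (y₀ : H)‖ ^ q' := by
  choose h hh using SepOp.exists_isSupportPoint hbump hcont hnt
  have hmap : ∀ y, SepOp.supportMap T y = h y := fun y => (hh y).supportMap_eq hsep
  obtain ⟨S, hS⟩ := hΦ
  rw [SepOp.coeff, hmap] at hS
  have hTS := right_ne_zero_of_smul hS
  obtain ⟨C, hC⟩ :=
    (SepOp.isBigO_norm_sub_pow_of_forall_isSupportPoint hbump hcont hsep hh hi hTS hq').bound
  obtain ⟨ε, hε, hεC⟩ := Metric.eventually_nhds_iff.1 (eventually_nhdsWithin_iff.1 hC)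
  obtain ⟨δ, hδ, hδY⟩ := Metric.isOpen_iff.1 Y.isOpen y₀ y₀.2
  refine ⟨min ε δ, lt_min hε hδ, (Metric.ball_subset_ball (min_le_right ε δ)).trans hδY, C,
    fun y hy hne => ?_⟩
  rw [hmap, hmap] at hne ⊢
  have hεy : dist y y₀ < ε := (Metric.mem_ball.1 hy).trans_le (min_le_left ε δ)
  simpa using hεC hεy fun heq => hne (congrArg Subtype.val heq)

theorem theorem12
    {G E H F : Type*}
    [NormedAddCommGroup G] [NormedSpace ℝ G] [CompleteSpace G]
    [NormedAddCommGroup E] [NormedSpace ℝ E] [CompleteSpace E]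
    [NormedAddCommGroup H] [NormedSpace ℝ H] [CompleteSpace H]
    [NormedAddCommGroup F] [NormedSpace ℝ F] [CompleteSpace F]
    (p : ℕ) (hp : 1 ≤ p) (q : ℕ∞) (hbump : SepOp.HasBump (p : ℕ∞) G)
    (X : TopologicalSpace.Opens G) (Y : TopologicalSpace.Opens H)
    (T : SepOp.Ck (p : ℕ∞) X E →ₗ[ℝ] SepOp.Ck q Y F)
    (hsep : SepOp.Separating T) (hnt : SepOp.NowhereTrivial T) (hcont : Continuous T)
    (y₀ : Y) (i : ℕ) (hi : i ≤ p) (hΦ : ∃ S : SepOp.SymMul i G E, SepOp.coeff T i y₀ S ≠ 0)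
    (q' : ℕ) (hq' : (q' : ℕ∞) ≤ q) :
    ∃ r : ℝ, 0 < r ∧ Metric.ball (y₀ : H) r ⊆ Y ∧ ∃ C : ℝ,
      ∀ y : Y, (y : H) ∈ Metric.ball (y₀ : H) r →
        SepOp.supportMap T y ≠ SepOp.supportMap T y₀ →
        ‖SepOp.supportMap T y - SepOp.supportMap T y₀‖ ^ (p - i) ≤
          C * ‖(y : H) - (y₀ : H)‖ ^ q' :=
  theorem12_general p q hbump X Y T hsep hnt hcont y₀ i hi hΦ q' hq'
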